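/- Consider randomized random access machines on integers with unit cost: a program is a fixed finite list of instructions acting on integer registers (addressed directly, without indirect addressing), and each executed instruction counts as one step. The instructions are: load an integer constant, $+$, $-$, $\times$, integer division $\operatorname{div}$ (with $x\operatorname{div}y=\lfloor x/y\rfloor$ for $y\neq 0$; a division by zero never completes), a conditional jump on a comparison $x\le y$, and the toss of a fair coin, independent of all earlier ones, which stores a random bit in a register. The input is placed in the first register (all others initially hold $0$), and the output is the content of the first register when the program halts. There exist a single program, a constant $\delta>0$ and a function $T:\mathbb{N}\to\mathbb{N}$ with $T(N)=\mathcal{O}\big(\log^2 N/\log\log N\big)$ as $N\to\infty$, such that, for every input $N\in\mathbb{N}$, the program halts within $T(N)$ steps whatever the outcomes of its coin tosses, and with probability at least $\delta$ its output is a prime $p\ge N$. -/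

import Mathlib

/-!
Randomized random access machines over `(+, -, ×, div)` with unit cost.

A machine has integer registers `R₀, R₁, R₂, …`, and a program is a finite list of instructions.
Registers are addressed directly only (there is no indirect addressing), so that a program
touches only finitely many of them. Every executed instruction costs one step, whatever the size
of the integers involved; this includes loading a constant, a comparison and a coin toss.
-/

namespace RandomizedRAM

/-- The instructions. `d` is the destination register, `a` and `b` are operand registers. -/
inductive Instr : Type
  /-- `R_d := z`, for an integer constant `z` -/
  | const (d : ℕ) (z : ℤ)
  /-- `R_d := R_a + R_b` -/
  | add (d a b : ℕ)
  /-- `R_d := R_a - R_b` -/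
  | sub (d a b : ℕ)
  /-- `R_d := R_a * R_b` -/
  | mul (d a b : ℕ)
  /-- `R_d := R_a div R_b`, the floor of the quotient; undefined when `R_b = 0` -/
  | div (d a b : ℕ)
  /-- `if R_a ≤ R_b then goto l` -/
  | jle (a b l : ℕ)
  /-- `R_d := 0` or `R_d := 1`, each with probability `1 / 2`, independently of the past -/
  | flip (d : ℕ)

/-- A program is a finite list of instructions, numbered from `0`. -/
abbrev Program : Type := List Instr

/-- A configuration: the number of the next instruction and the contents of the registers. -/
@[ext]
structure Config : Type where
  /-- number of the next instruction -/
  pc : ℕ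
  /-- contents of the registers -/
  reg : ℕ → ℤ

namespace Config

/-- Store `z` in register `d` and proceed to the next instruction. -/
def store (c : Config) (d : ℕ) (z : ℤ) : Config :=
  ⟨c.pc + 1, Function.update c.reg d z⟩

/-- The machine has halted when there is no instruction to execute next. -/
def Halted (P : Program) (c : Config) : Prop := P.length ≤ c.pc

/-- The initial configuration on input `N`: `R₀ = N`, all other registers contain `0`. -/
def start (N : ℕ) : Config := ⟨0, fun r => if r = 0 then (N : ℤ) else 0⟩

end Config

/-- The probability distribution of the configuration after one step from `c`. A halted
configuration stays as it is; an attempted division by zero hangs the machine for ever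
(without halting). -/
noncomputable def step (P : Program) (c : Config) : PMF Config :=
  match P[c.pc]? with
  | none => PMF.pure c
  | some (.const d z) => PMF.pure (c.store d z)
  | some (.add d a b) => PMF.pure (c.store d (c.reg a + c.reg b))
  | some (.sub d a b) => PMF.pure (c.store d (c.reg a - c.reg b))
  | some (.mul d a b) => PMF.pure (c.store d (c.reg a * c.reg b))
  | some (.div d a b) =>
      if c.reg b = 0 then PMF.pure c else PMF.pure (c.store d (Int.fdiv (c.reg a) (c.reg b)))
  | some (.jle a b l) =>
      if c.reg a ≤ c.reg b then PMF.pure ⟨l, c.reg⟩ else PMF.pure ⟨c.pc + 1, c.reg⟩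
  | some (.flip d) => (PMF.uniformOfFintype Bool).map fun x => c.store d (if x then 1 else 0)

/-- The probability distribution of the configuration after `t` steps from `c`. -/
noncomputable def law (P : Program) : ℕ → Config → PMF Config
  | 0, c => PMF.pure c
  | t + 1, c => (step P c).bind (law P t)

/-- On input `N` the program halts after at most `t` steps, whatever the coin tosses. -/
def HaltsWithin (P : Program) (N t : ℕ) : Prop :=
  ∀ c ∈ (law P t (Config.start N)).support, c.Halted P

/-- The probability that on input `N` the program halts within `t` steps with an output
(the final contents of `R₀`) that satisfies `Q`. -/
noncomputable def outputProb (P : Program) (N t : ℕ) (Q : ℤ → Prop) : ENNReal :=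
  (law P t (Config.start N)).toOuterMeasure {c | c.Halted P ∧ Q (c.reg 0)}

end RandomizedRAM

/-!
A deterministic program finds a prime `p ≥ N` in `O(log N)` steps, so that no coin is tossed and the
success probability is `1`; for large `N`, `log N` is at most `log N ^ 2 / log (log N)`.

The speed comes from integers of unbounded size. For `X > 2 ^ n` the binomial coefficients of
order `n` are the digits of `(1 + X) ^ n` in base `X` (`one_add_pow_div_pow_mod`), so each of them
costs `O(1)` steps once `(1 + X) ^ n` and a power of `X` are known. Let `m = 2 ^ k > N` be
the least such power of two and `X = 8 ^ m`. Along `k` squarings the program passes through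
`X ^ q` and `(1 + X) ^ q` for `q = 1, 2, 4, …, m`, and the recursion
`(2 * q)! = q ! ^ 2 * choose (2 * q) q` yields `m !` at the same time.

The test on which the search rests is whether `choose (2 * m) a` divides `m ! ^ 2`. For `0 ≤ a ≤ m`
it fails exactly if a prime lies in `(2 * m - a, 2 * m]`: such a prime divides the coefficient but
not `m !`, while a prime `p ≤ m` occurs in the coefficient at most to the power
`1 + log p m ≤ 2 * log p m`, and `p ^ log p m` divides `m !` (`exists_prime_dvd_choose`). If `a < m`
passes the test and `a + 1` does not, then `2 * m - a` is prime (`prime_two_mul_sub`). By Bertrand's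
postulate `a = m` does not pass (`not_choose_dvd`), and `a = 0` does, so that bisection with
the steps `q = m / 2, m / 4, …, 1` finds such an `a`. It needs the powers `X ^ q` in descending
order; as no cheap square root is available, they are taken from a stack, packed into one register
during the ascending phase (`powerStack`).

The machine is followed through straight-line blocks by rewriting, and through the three loops
by induction (`reaches_double_m`, `reaches_double_q`, `exists_reaches_halted_prime`).
-/

namespace RandomizedRAM

/-! ### Binomial coefficients and primes -/

/-- Coefficient extraction: if `X > 2 ^ n`, the binomial coefficients of order `n` are the digits
of `(1 + X) ^ n` in base `X`. -/
theorem one_add_pow_div_pow_mod {n j X : ℕ} (hX : 2 ^ n < X) (hj : j ≤ n) :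
    (1 + X) ^ n / X ^ j % X = n.choose j := by
  have hXpos : 0 < X := (Nat.zero_le _).trans_lt hX
  -- The part of the sum below `X ^ j`, the wanted digit, and the digits above it.
  have hsplit : (1 + X) ^ n = (∑ i ∈ Finset.range j, X ^ i * n.choose i) +
      X ^ j * (n.choose j + X * ∑ i ∈ Finset.range (n - j), X ^ i * n.choose (j + 1 + i)) := by
    obtain ⟨r, rfl⟩ := Nat.exists_eq_add_of_le hj
    rw [add_comm 1 X, add_pow, add_tsub_cancel_left]
    simp only [one_pow, mul_one, Nat.cast_id]
    rw [show j + r + 1 = (j + 1) + r by ring, Finset.sum_range_add, Finset.sum_range_succ,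
      mul_add, Finset.mul_sum, Finset.mul_sum, add_assoc]
    congr 2
    exact Finset.sum_congr rfl fun i _ => by ring
  have hlow : ∑ i ∈ Finset.range j, X ^ i * n.choose i < X ^ j := by
    rcases j with _ | j
    · simp
    calc ∑ i ∈ Finset.range (j + 1), X ^ i * n.choose i
        ≤ ∑ i ∈ Finset.range (j + 1), X ^ j * n.choose i := by
          refine Finset.sum_le_sum fun i hi => ?_
          have := Finset.mem_range.1 hi
          gcongr
          · omega
      _ ≤ ∑ i ∈ Finset.range (n + 1), X ^ j * n.choose i :=
          Finset.sum_le_sum_of_subset (Finset.range_mono (by omega))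
      _ = X ^ j * 2 ^ n := by rw [← Finset.mul_sum, Nat.sum_range_choose]
      _ < X ^ (j + 1) := by rw [pow_succ]; gcongr
  have hdig : n.choose j < X :=
    lt_of_le_of_lt (Nat.choose_le_two_pow n j) hX
  rw [hsplit, Nat.add_mul_div_left _ _ (by positivity), Nat.div_eq_of_lt hlow, zero_add,
    Nat.add_mul_mod_self_left, Nat.mod_eq_of_lt hdig]

theorem factorial_two_mul (q : ℕ) :
    (2 * q).factorial = q.factorial * q.factorial * (2 * q).choose q := by
  have h := Nat.choose_mul_factorial_mul_factorial (show q ≤ 2 * q by omega)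
  rw [show 2 * q - q = q by omega] at h
  rw [← h]; ring

/-- The powers of a prime `p ≤ m` that divide a binomial coefficient of order `2 * m` are at most
`p ^ (1 + log p m)`, hence they all divide `m ! ^ 2`; only a prime above `m` can be the obstacle. -/
theorem exists_prime_dvd_choose {m j : ℕ} (hj : j ≤ 2 * m)
    (h : ¬ (2 * m).choose j ∣ m.factorial * m.factorial) :
    ∃ p, p.Prime ∧ m < p ∧ p ∣ (2 * m).choose j := by
  by_contra! hcon
  refine h ?_
  have hf : m.factorial ≠ 0 := m.factorial_ne_zero
  rw [← Nat.factorization_prime_le_iff_dvd (Nat.choose_pos hj).ne' (mul_ne_zero hf hf)]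
  intro p hp
  by_cases hpm : m < p
  · rw [Nat.factorization_eq_zero_of_not_dvd (hcon p hp hpm)]
    exact Nat.zero_le _
  have hpm : p ≤ m := not_lt.1 hpm
  have h1 : ((2 * m).choose j).factorization p ≤ Nat.log p m + 1 := by
    refine Nat.factorization_choose_le_log.trans ?_
    rw [← Nat.log_mul_base hp.one_lt (by have := hp.pos; omega), mul_comm m]
    exact Nat.log_mono_right (Nat.mul_le_mul_right m hp.two_le)
  have h2 : 1 ≤ Nat.log p m := Nat.log_pos hp.one_lt hpm
  have h3 : Nat.log p m ≤ m.factorial.factorization p := by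
    rw [← hp.pow_dvd_iff_le_factorization hf]
    exact Nat.dvd_factorial (pow_pos hp.pos _) (Nat.pow_log_le_self p (by have := hp.pos; omega))
  rw [Nat.factorization_mul hf hf, Finsupp.add_apply]
  omega

/-- A prime above `m` that divides `choose (2 * m) (a + 1)` but not `choose (2 * m) a` divides
`2 * m - a`, a number less than `2 * (m + 1)`, and hence equals it. -/
theorem prime_two_mul_sub {m a : ℕ} (ha : a < m)
    (h0 : (2 * m).choose a ∣ m.factorial * m.factorial)
    (h1 : ¬ (2 * m).choose (a + 1) ∣ m.factorial * m.factorial) :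
    (2 * m - a).Prime := by
  obtain ⟨p, hp, hmp, hdvd⟩ := exists_prime_dvd_choose (by omega) h1
  have hpf : ¬ p ∣ (2 * m).choose a := by
    intro h
    rcases hp.dvd_mul.1 (h.trans h0) with h | h <;>
      exact absurd (hp.dvd_factorial.1 h) (by omega)
  have h2 : p ∣ (2 * m).choose a * (2 * m - a) := by
    rw [← Nat.choose_succ_right_eq]
    exact hdvd.mul_right _
  obtain ⟨c, hc⟩ := (hp.dvd_mul.1 h2).resolve_left hpf
  have hc1 : c = 1 := by
    have : c < 2 := by
      by_contra! h
      have := Nat.mul_le_mul_left p h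
      omega
    have : c ≠ 0 := by rintro rfl; omega
    omega
  rw [hc, hc1, mul_one]
  exact hp

/-- This is Bertrand's postulate: a prime in `(m, 2 * m]` divides the central binomial coefficient
but not `m !`. -/
theorem not_choose_dvd {m : ℕ} (hm : m ≠ 0) :
    ¬ (2 * m).choose m ∣ m.factorial * m.factorial := by
  obtain ⟨p, hp, h1, h2⟩ := Nat.exists_prime_lt_and_le_two_mul m hm
  intro h
  have h3 : p ∣ (2 * m).factorial := hp.dvd_factorial.2 h2
  rw [factorial_two_mul] at h3
  have h4 : p ∣ m.factorial * m.factorial := by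
    rcases hp.dvd_mul.1 h3 with h3 | h3
    · exact h3
    · exact h3.trans h
  rcases hp.dvd_mul.1 h4 with h | h <;> exact absurd (hp.dvd_factorial.1 h) (by omega)

/-! ### Runs without coin tosses -/

/-- The deterministic successor of a configuration. Coin tosses, which have none, leave the
configuration unchanged. -/
def next (P : Program) (c : Config) : Config :=
  match P[c.pc]? with
  | none => c
  | some (.const d z) => c.store d z
  | some (.add d a b) => c.store d (c.reg a + c.reg b)
  | some (.sub d a b) => c.store d (c.reg a - c.reg b)
  | some (.mul d a b) => c.store d (c.reg a * c.reg b)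
  | some (.div d a b) => if c.reg b = 0 then c else c.store d (Int.fdiv (c.reg a) (c.reg b))
  | some (.jle a b l) => if c.reg a ≤ c.reg b then ⟨l, c.reg⟩ else ⟨c.pc + 1, c.reg⟩
  | some (.flip _) => c

/-- A program without coin tosses. -/
def FlipFree (P : Program) : Prop := ∀ d, Instr.flip d ∉ P

theorem step_eq_pure {P : Program} (hP : FlipFree P) (c : Config) :
    step P c = PMF.pure (next P c) := by
  rcases h : P[c.pc]? with _ | i
  · simp only [step, next, h]
  · cases i with
    | flip d => exact absurd (List.mem_of_getElem? h) (hP d)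
    | div d a b => simp only [step, next, h]; split <;> rfl
    | jle a b l => simp only [step, next, h]; split <;> rfl
    | _ => simp only [step, next, h]

theorem law_eq_pure {P : Program} (hP : FlipFree P) (t : ℕ) (c : Config) :
    law P t c = PMF.pure ((next P)^[t] c) := by
  induction t generalizing c with
  | zero => rfl
  | succ t ih => rw [law, step_eq_pure hP, PMF.pure_bind, ih, Function.iterate_succ_apply]

theorem iterate_next_of_halted {P : Program} {c : Config} (h : c.Halted P) (t : ℕ) :
    (next P)^[t] c = c := by
  refine Function.iterate_fixed ?_ t
  rw [next, List.getElem?_eq_none h]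

/-- From `c` the program `P`, which tosses no coins, arrives at `c'` after at most `t` steps. -/
def Reaches (P : Program) (t : ℕ) (c c' : Config) : Prop := ∃ s ≤ t, (next P)^[s] c = c'

theorem Reaches.of_iterate {P : Program} {t : ℕ} {c c' : Config} (h : (next P)^[t] c = c') :
    Reaches P t c c' := ⟨t, le_rfl, h⟩

theorem Reaches.trans {P : Program} {t₁ t₂ : ℕ} {c₁ c₂ c₃ : Config} (h₁ : Reaches P t₁ c₁ c₂)
    (h₂ : Reaches P t₂ c₂ c₃) : Reaches P (t₁ + t₂) c₁ c₃ := by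
  obtain ⟨s₁, hs₁, rfl⟩ := h₁
  obtain ⟨s₂, hs₂, rfl⟩ := h₂
  exact ⟨s₂ + s₁, by omega, Function.iterate_add_apply _ _ _ _⟩

theorem Reaches.mono {P : Program} {t t' : ℕ} {c c' : Config} (h : Reaches P t c c')
    (ht : t ≤ t') : Reaches P t' c c' := by
  obtain ⟨s, hs, h⟩ := h
  exact ⟨s, hs.trans ht, h⟩

theorem Reaches.iterate_eq {P : Program} {t : ℕ} {c c' : Config} (h : Reaches P t c c')
    (hc' : c'.Halted P) : (next P)^[t] c = c' := by
  obtain ⟨s, hs, h⟩ := h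
  obtain ⟨r, rfl⟩ := Nat.exists_eq_add_of_le' hs
  rw [Function.iterate_add_apply, h, iterate_next_of_halted hc']

/-- A computation without coin tosses that reaches a halting configuration produces its output
surely. -/
theorem Reaches.haltsWithin_and_outputProb {P : Program} (hP : FlipFree P) {N t : ℕ} {c : Config}
    {Q : ℤ → Prop} (h : Reaches P t (Config.start N) c) (hc : c.Halted P) (hQ : Q (c.reg 0)) :
    HaltsWithin P N t ∧ outputProb P N t Q = 1 := by
  have hlaw : law P t (Config.start N) = PMF.pure c := by
    rw [law_eq_pure hP, h.iterate_eq hc]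
  refine ⟨?_, ?_⟩
  · intro c' hc'
    rw [hlaw, PMF.support_pure, Set.mem_singleton_iff] at hc'
    exact hc' ▸ hc
  · rw [outputProb, hlaw, PMF.toOuterMeasure_pure_apply, if_pos ⟨hc, hQ⟩]

/-! ### The program -/

/-- The configuration at instruction `pc` whose registers hold the entries of `l`, followed
by zeros. -/
def conf (pc : ℕ) (l : List ℤ) : Config := ⟨pc, fun i => l.getD i 0⟩

theorem store_conf {d : ℕ} {l : List ℤ} (hd : d < l.length) (pc : ℕ) (z : ℤ) :
    (conf pc l).store d z = conf (pc + 1) (l.set d z) := by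
  ext r
  · rfl
  · by_cases h : r = d
    · subst h
      simp [Config.store, conf, List.getD, hd]
    · simp [Config.store, conf, List.getD, List.getElem?_set_ne (Ne.symm h), h]

/-- A program that computes a prime `p ≥ N`. Registers: `R₀ = N + 1` at first and `2 * m - a` in
the end, `R₁ = 1`, `R₂ = m`, `R₃ = X`, `R₄ = B`, `R₅ = q`, `R₆ = X ^ q` and then `X ^ a`,
`R₇ = (1 + X) ^ q` and then `(1 + X) ^ (2 * m)`, `R₈ = q !` and then `m ! ^ 2`, `R₉` is the stack,
`R₁₂ = 2`, the others are auxiliary. -/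
def primeProgram : Program := [
  -- `m := 1`, `X := 8`, `B := 8`, `R₀ := N + 1`
  .const 1 1, .const 2 1, .const 3 8, .const 4 8, .add 0 0 1,
  -- 5: double `m` until `N + 1 ≤ m`, with `X = 8 ^ m` and `B = X ^ m`
  .jle 0 2 11, .add 2 2 2, .mul 3 3 3, .mul 4 4 4, .mul 4 4 4, .jle 1 1 5,
  -- 11: `q := 1`
  .const 5 1, .mul 6 3 1, .add 7 3 1, .const 8 1,
  -- 15: double `q` until `q = m`; push `X ^ q`, and `(2 * q)! = q ! ^ 2 * choose (2 * q) q`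
  .jle 2 5 28, .mul 9 9 4, .add 9 9 6, .mul 7 7 7, .div 10 7 6, .div 11 10 3, .mul 11 11 3,
  .sub 10 10 11, .mul 8 8 8, .mul 8 8 10, .mul 6 6 6, .add 5 5 5, .jle 1 1 15,
  -- 28: `a := 0`
  .mul 7 7 7, .mul 8 8 8, .add 0 2 2, .const 6 1, .const 12 2,
  -- 33: halve `q` until `q = 1`; pop `X ^ q`, and test whether `choose (2 * m) (a + q)`
  -- divides `m ! ^ 2`
  .jle 5 1 51, .div 5 5 12, .div 10 9 4, .mul 11 10 4, .sub 11 9 11, .div 9 9 4, .mul 11 11 6,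
  .div 10 7 11, .div 13 10 3, .mul 13 13 3, .sub 10 10 13, .div 13 8 10, .mul 13 13 10,
  .jle 8 13 48, .jle 1 1 33,
  -- 48: if so, `a := a + q`
  .sub 0 0 5, .mul 6 11 1, .jle 1 1 33]

theorem flipFree_primeProgram : FlipFree primeProgram := by
  intro d h
  simp [primeProgram] at h

/-! ### Single instructions -/

section next

variable {P : Program} {pc : ℕ} {l : List ℤ} {d a b : ℕ}

theorem next_const {z : ℤ} (h : P[pc]? = some (.const d z)) (hd : d < l.length) :
    next P (conf pc l) = conf (pc + 1) (l.set d z) := by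
  rw [← store_conf hd, next]; simp [conf, h]

theorem next_add (h : P[pc]? = some (.add d a b)) (hd : d < l.length) :
    next P (conf pc l) = conf (pc + 1) (l.set d (l.getD a 0 + l.getD b 0)) := by
  rw [← store_conf hd, next]; simp [conf, h]

theorem next_sub (h : P[pc]? = some (.sub d a b)) (hd : d < l.length) :
    next P (conf pc l) = conf (pc + 1) (l.set d (l.getD a 0 - l.getD b 0)) := by
  rw [← store_conf hd, next]; simp [conf, h]

theorem next_mul (h : P[pc]? = some (.mul d a b)) (hd : d < l.length) :
    next P (conf pc l) = conf (pc + 1) (l.set d (l.getD a 0 * l.getD b 0)) := by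
  rw [← store_conf hd, next]; simp [conf, h]

theorem next_div (h : P[pc]? = some (.div d a b)) (hd : d < l.length) (hb : l.getD b 0 ≠ 0) :
    next P (conf pc l) = conf (pc + 1) (l.set d (Int.fdiv (l.getD a 0) (l.getD b 0))) := by
  rw [← store_conf hd, next]; simp only [show (conf pc l).pc = pc from rfl, h]
  exact if_neg hb

theorem next_jle_of_le {k : ℕ} (h : P[pc]? = some (.jle a b k)) (hab : l.getD a 0 ≤ l.getD b 0) :
    next P (conf pc l) = conf k l := by
  rw [next]; simp only [show (conf pc l).pc = pc from rfl, h]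
  exact if_pos hab

theorem next_jle_of_lt {k : ℕ} (h : P[pc]? = some (.jle a b k)) (hab : l.getD b 0 < l.getD a 0) :
    next P (conf pc l) = conf (pc + 1) l := by
  rw [next]; simp only [show (conf pc l).pc = pc from rfl, h]
  exact if_neg hab.not_ge

end next

theorem start_eq_conf (N : ℕ) :
    Config.start N = conf 0 [(N : ℤ), 0, 0, 0, 0, 0, 0, 0, 0, 0, 0, 0, 0, 0] := by
  ext r
  · rfl
  · rcases r with _ | r
    · rfl
    · by_cases h : r < 13
      · interval_cases r <;> rfl
      · simp [Config.start, conf, List.getD, show 13 ≤ r by omega]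

/-! ### Straight-line blocks -/

theorem block_start (N : ℕ) :
    (next primeProgram)^[5] (Config.start N) =
      conf 5 [(N : ℤ) + 1, 1, 1, 8, 8, 0, 0, 0, 0, 0, 0, 0, 0, 0] := by
  rw [start_eq_conf]
  simp only [Function.iterate_succ_apply, Function.iterate_zero, id]
  iterate 4 rw [next_const rfl (by simp)]
  rw [next_add rfl (by simp)]
  rfl

theorem block_double_m {n m X B : ℤ} (l : List ℤ) (h : m < n) :
    (next primeProgram)^[6] (conf 5 (n :: 1 :: m :: X :: B :: l)) =
      conf 5 (n :: 1 :: (m + m) :: (X * X) :: (B * B * (B * B)) :: l) := by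
  simp only [Function.iterate_succ_apply, Function.iterate_zero, id]
  rw [next_jle_of_lt rfl (by simpa using h), next_add rfl (by simp)]
  iterate 3 rw [next_mul rfl (by simp)]
  rw [next_jle_of_le rfl (by simp)]
  rfl

theorem block_init_q {n m X B : ℤ} (h : n ≤ m) :
    (next primeProgram)^[5] (conf 5 [n, 1, m, X, B, 0, 0, 0, 0, 0, 0, 0, 0, 0]) =
      conf 15 [n, 1, m, X, B, 1, X * 1, X + 1, 1, 0, 0, 0, 0, 0] := by
  simp only [Function.iterate_succ_apply, Function.iterate_zero, id]
  rw [next_jle_of_le rfl (by simpa using h), next_const rfl (by simp), next_mul rfl (by simp),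
    next_add rfl (by simp), next_const rfl (by simp)]
  rfl

theorem block_double_q {n m X B q y w f S C u v r s : ℤ} (h : q < m) (hy : y ≠ 0) (hX : X ≠ 0)
    (hC : Int.fdiv (w * w) y - Int.fdiv (Int.fdiv (w * w) y) X * X = C) :
    (next primeProgram)^[13] (conf 15 [n, 1, m, X, B, q, y, w, f, S, u, v, r, s]) =
      conf 15 [n, 1, m, X, B, q + q, y * y, w * w, f * f * C, S * B + y, C,
        Int.fdiv (Int.fdiv (w * w) y) X * X, r, s] := by
  subst hC
  simp only [Function.iterate_succ_apply, Function.iterate_zero, id]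
  rw [next_jle_of_lt rfl (by simpa using h), next_mul rfl (by simp), next_add rfl (by simp),
    next_mul rfl (by simp), next_div rfl (by simp) (by simpa using hy),
    next_div rfl (by simp) (by simpa using hX), next_mul rfl (by simp), next_sub rfl (by simp),
    next_mul rfl (by simp), next_mul rfl (by simp), next_mul rfl (by simp),
    next_add rfl (by simp), next_jle_of_le rfl (by simp)]
  rfl

theorem block_init_a {n m X B q y w f S u v r s : ℤ} (h : m ≤ q) :
    (next primeProgram)^[6] (conf 15 [n, 1, m, X, B, q, y, w, f, S, u, v, r, s]) =
      conf 33 [m + m, 1, m, X, B, q, 1, w * w, f * f, S, u, v, 2, s] := by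
  simp only [Function.iterate_succ_apply, Function.iterate_zero, id]
  rw [next_jle_of_le rfl (by simpa using h), next_mul rfl (by simp), next_mul rfl (by simp),
    next_add rfl (by simp), next_const rfl (by simp), next_const rfl (by simp)]
  rfl

theorem block_test {n m X B q q' y Y w f S S' C D u v s : ℤ} (h : 1 < q) (hB : B ≠ 0)
    (hy : y * Y ≠ 0) (hX : X ≠ 0) (hC0 : C ≠ 0) (hq' : Int.fdiv q 2 = q')
    (hS' : Int.fdiv S B = S') (hyS : S - S' * B = y)
    (hC : Int.fdiv w (y * Y) - Int.fdiv (Int.fdiv w (y * Y)) X * X = C)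
    (hD : Int.fdiv f C * C = D) :
    (next primeProgram)^[13] (conf 33 [n, 1, m, X, B, q, Y, w, f, S, u, v, 2, s]) =
      conf 46 [n, 1, m, X, B, q', Y, w, f, S', C, y * Y, 2, D] := by
  subst hq' hS' hyS hC hD
  simp only [Function.iterate_succ_apply, Function.iterate_zero, id]
  rw [next_jle_of_lt rfl (by simpa using h), next_div rfl (by simp) (by simp),
    next_div rfl (by simp) (by simpa using hB), next_mul rfl (by simp), next_sub rfl (by simp),
    next_div rfl (by simp) (by simpa using hB), next_mul rfl (by simp),
    next_div rfl (by simp) (by simpa using hy), next_div rfl (by simp) (by simpa using hX),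
    next_mul rfl (by simp), next_sub rfl (by simp),
    next_div rfl (by simp) (by simpa using hC0), next_mul rfl (by simp)]
  rfl

theorem block_pass {n m X B q Y w f S C z D : ℤ} (h : f ≤ D) :
    (next primeProgram)^[4] (conf 46 [n, 1, m, X, B, q, Y, w, f, S, C, z, 2, D]) =
      conf 33 [n - q, 1, m, X, B, q, z * 1, w, f, S, C, z, 2, D] := by
  simp only [Function.iterate_succ_apply, Function.iterate_zero, id]
  rw [next_jle_of_le rfl (by simpa using h), next_sub rfl (by simp), next_mul rfl (by simp),
    next_jle_of_le rfl (by simp)]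
  rfl

theorem block_fail {n m X B q Y w f S C z D : ℤ} (h : D < f) :
    (next primeProgram)^[2] (conf 46 [n, 1, m, X, B, q, Y, w, f, S, C, z, 2, D]) =
      conf 33 [n, 1, m, X, B, q, Y, w, f, S, C, z, 2, D] := by
  simp only [Function.iterate_succ_apply, Function.iterate_zero, id]
  rw [next_jle_of_lt rfl (by simpa using h), next_jle_of_le rfl (by simp)]

theorem block_exit {n q : ℤ} {m X B : ℤ} {l : List ℤ} (h : q ≤ 1) :
    (next primeProgram)^[1] (conf 33 (n :: 1 :: m :: X :: B :: q :: l)) =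
      conf 51 (n :: 1 :: m :: X :: B :: q :: l) := by
  simp only [Function.iterate_succ_apply, Function.iterate_zero, id]
  rw [next_jle_of_le rfl (by simpa using h)]

/-! ### The three loops -/

/-- The stack with the entries `X, X ^ 2, X ^ 4, …, X ^ (2 ^ (i - 1))`, encoded as one number with
these digits in base `B`. The top of the stack is the last entry, in the least significant
place. -/
def powerStack (B X : ℕ) : ℕ → ℕ
  | 0 => 0
  | i + 1 => powerStack B X i * B + X ^ 2 ^ i

theorem natCast_sub_fdiv_mul (a b : ℕ) : (a : ℤ) - Int.fdiv a b * b = (a % b : ℕ) := by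
  rw [← Int.ofNat_fdiv, sub_eq_iff_eq_add]
  exact_mod_cast (Nat.mod_add_div' a b).symm

/-- The first loop: as long as `m` is below `n`, it is doubled, with `X = 8 ^ m` and `B = X ^ m` kept
up to date. -/
theorem reaches_double_m {n : ℕ} (l : List ℤ) {i : ℕ} (hi : ∀ j < i, 2 ^ j < n) :
    Reaches primeProgram (6 * i) (conf 5 (n :: 1 :: 1 :: 8 :: 8 :: l))
      (conf 5 (n :: 1 :: (2 ^ i : ℕ) :: (8 ^ 2 ^ i : ℕ) :: ((8 ^ 2 ^ i) ^ 2 ^ i : ℕ) :: l)) := by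
  induction i with
  | zero => exact Reaches.of_iterate rfl
  | succ i ih =>
    refine (ih fun j hj => hi j (by omega)).trans (t₂ := 6) (Reaches.of_iterate ?_)
    rw [block_double_m _ (by exact_mod_cast hi i (by omega))]
    congr <;> norm_cast <;> ring

/-- The second loop: `q` is doubled up to `m`, and `X ^ q`, `(1 + X) ^ q`, `q !` and the stack of the
earlier powers of `X` are kept up to date. The entries `u` and `v` are scratch registers. -/
theorem reaches_double_q {n m X B i : ℕ} (hi : 2 ^ i ≤ m) (hX : 2 ^ (2 * m) < X) :
    ∃ u v : ℤ, Reaches primeProgram (13 * i)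
      (conf 15 [n, 1, m, X, B, 1, X * 1, X + 1, 1, 0, 0, 0, 0, 0])
      (conf 15 [n, 1, m, X, B, (2 ^ i : ℕ), (X ^ 2 ^ i : ℕ), ((1 + X) ^ 2 ^ i : ℕ),
        ((2 ^ i).factorial : ℕ), (powerStack B X i : ℕ), u, v, 0, 0]) := by
  induction i with
  | zero => exact ⟨0, 0, Reaches.of_iterate (by simp [powerStack, add_comm])⟩
  | succ i ih =>
    have hlt : 2 ^ i < m := (Nat.pow_lt_pow_succ (by norm_num)).trans_le hi
    have hX0 : X ≠ 0 := by rintro rfl; simp at hX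
    obtain ⟨u, v, h⟩ := ih hlt.le
    have hC : Int.fdiv (((1 + X) ^ 2 ^ i : ℕ) * ((1 + X) ^ 2 ^ i : ℕ)) (X ^ 2 ^ i : ℕ) -
        Int.fdiv (Int.fdiv (((1 + X) ^ 2 ^ i : ℕ) * ((1 + X) ^ 2 ^ i : ℕ)) (X ^ 2 ^ i : ℕ)) X * X =
        ((2 * 2 ^ i).choose (2 ^ i) : ℕ) := by
      rw [← Nat.cast_mul, ← Int.ofNat_fdiv, natCast_sub_fdiv_mul, ← pow_add, ← two_mul,
        one_add_pow_div_pow_mod _ (by omega)]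
      refine lt_of_le_of_lt (Nat.pow_le_pow_right (by norm_num) ?_) hX
      omega
    have hy0 : ((X ^ 2 ^ i : ℕ) : ℤ) ≠ 0 := by exact_mod_cast pow_ne_zero _ hX0
    have hblock := block_double_q (n := n) (m := m) (B := B) (q := (2 ^ i : ℕ))
      (f := ((2 ^ i).factorial : ℕ)) (S := (powerStack B X i : ℕ)) (u := u) (v := v) (r := 0)
      (s := 0) (by exact_mod_cast hlt) hy0 (by exact_mod_cast hX0) hC
    have htwo : 2 ^ i + 2 ^ i = 2 ^ (i + 1) := by ring
    have hfac := (factorial_two_mul (2 ^ i)).symm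
    rw [← pow_succ'] at hfac
    simp only [← Nat.cast_mul, ← Nat.cast_add, ← pow_add, htwo, ← pow_succ', hfac] at hblock
    exact ⟨_, _, h.trans (Reaches.of_iterate hblock)⟩

/-- The third loop, with `q = 2 ^ i`: bisection between `a`, which passes the divisibility test, and
`a + q`, which does not. When `q = 1` the first register holds the prime `2 * m - a`. -/
theorem exists_reaches_halted_prime {m X B : ℕ} (hX : 2 ^ (2 * m) < X)
    (hB : X ^ m ≤ B) (i : ℕ) : ∀ (a : ℕ) (u v s : ℤ), a + 2 ^ i ≤ m →
      (2 * m).choose a ∣ m.factorial * m.factorial →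
      ¬ (2 * m).choose (a + 2 ^ i) ∣ m.factorial * m.factorial →
      ∃ c, Reaches primeProgram (17 * i + 1)
        (conf 33 [(2 * m - a : ℕ), 1, m, X, B, (2 ^ i : ℕ), (X ^ a : ℕ), ((1 + X) ^ (2 * m) : ℕ),
          (m.factorial * m.factorial : ℕ), (powerStack B X i : ℕ), u, v, 2, s]) c ∧
        c.Halted primeProgram ∧ ∃ p : ℕ, p.Prime ∧ m < p ∧ c.reg 0 = p := by
  induction i with
  | zero =>
    intro a u v s ha h0 h1
    refine ⟨_, Reaches.of_iterate (block_exit (by simp)), le_of_eq (by rfl), 2 * m - a,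
      prime_two_mul_sub (by simpa using ha) h0 h1, by simp at ha; omega, rfl⟩
  | succ i ih =>
    intro a u v s ha h0 h1
    have hX0 : X ≠ 0 := by rintro rfl; simp at hX
    have h2 : 2 ^ (i + 1) = 2 ^ i + 2 ^ i := by ring
    have hpos : 0 < 2 ^ i := by positivity
    have hyB : X ^ 2 ^ i < B := by
      refine lt_of_lt_of_le (Nat.pow_lt_pow_right ?_ (by omega)) hB
      exact lt_of_le_of_lt Nat.one_le_two_pow hX
    have hB0 : B ≠ 0 := by omega
    have hdiv : powerStack B X (i + 1) / B = powerStack B X i := by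
      rw [powerStack, Nat.mul_comm, Nat.mul_add_div (by omega), Nat.div_eq_of_lt hyB, add_zero]
    have hq' : Int.fdiv (2 ^ (i + 1) : ℕ) 2 = (2 ^ i : ℕ) := by
      rw [show (2 : ℤ) = (2 : ℕ) from rfl, ← Int.ofNat_fdiv, pow_succ,
        Nat.mul_div_cancel _ (by norm_num)]
    have hS' : Int.fdiv (powerStack B X (i + 1) : ℕ) B = (powerStack B X i : ℕ) := by
      rw [← Int.ofNat_fdiv, hdiv]
    have hyS : ((powerStack B X (i + 1) : ℕ) : ℤ) - (powerStack B X i : ℕ) * B =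
        (X ^ 2 ^ i : ℕ) := by
      rw [powerStack]; push_cast; ring
    have hyY : ((X ^ 2 ^ i : ℕ) : ℤ) * (X ^ a : ℕ) = (X ^ (a + 2 ^ i) : ℕ) := by
      push_cast; ring
    have hC : Int.fdiv ((1 + X) ^ (2 * m) : ℕ) ((X ^ 2 ^ i : ℕ) * (X ^ a : ℕ)) -
        Int.fdiv (Int.fdiv ((1 + X) ^ (2 * m) : ℕ) ((X ^ 2 ^ i : ℕ) * (X ^ a : ℕ))) X * X =
        ((2 * m).choose (a + 2 ^ i) : ℕ) := by
      rw [hyY, ← Int.ofNat_fdiv, natCast_sub_fdiv_mul, one_add_pow_div_pow_mod hX (by omega)]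
    have hC0 : (2 * m).choose (a + 2 ^ i) ≠ 0 := (Nat.choose_pos (by omega)).ne'
    have hD : Int.fdiv (m.factorial * m.factorial : ℕ) ((2 * m).choose (a + 2 ^ i) : ℕ) *
        ((2 * m).choose (a + 2 ^ i) : ℕ) = ((m.factorial * m.factorial) /
          (2 * m).choose (a + 2 ^ i) * (2 * m).choose (a + 2 ^ i) : ℕ) := by
      rw [← Int.ofNat_fdiv]; norm_cast
    -- `D` is the largest multiple of the coefficient that is at most `m ! ^ 2`, so divisibility
    -- amounts to `m ! ^ 2 ≤ D`.
    have htest := block_test (n := (2 * m - a : ℕ)) (m := m) (u := u) (v := v) (s := s)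
      (q := (2 ^ (i + 1) : ℕ)) (by exact_mod_cast (by omega : 1 < 2 ^ (i + 1)))
      (by exact_mod_cast hB0) (by rw [hyY]; exact_mod_cast pow_ne_zero _ hX0)
      (by exact_mod_cast hX0) (by exact_mod_cast hC0) hq' hS' hyS hC hD
    rw [hyY] at htest
    by_cases hdvd : (2 * m).choose (a + 2 ^ i) ∣ m.factorial * m.factorial
    · have hpass := block_pass (n := (2 * m - a : ℕ)) (m := m) (X := X) (B := B)
        (q := (2 ^ i : ℕ)) (Y := (X ^ a : ℕ)) (w := ((1 + X) ^ (2 * m) : ℕ))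
        (S := (powerStack B X i : ℕ)) (C := ((2 * m).choose (a + 2 ^ i) : ℕ))
        (z := (X ^ (a + 2 ^ i) : ℕ)) (Nat.cast_le.2 (Nat.div_mul_cancel hdvd).ge)
      rw [mul_one, ← Nat.cast_sub (by omega), Nat.sub_sub] at hpass
      obtain ⟨c, hc, hc'⟩ := ih (a + 2 ^ i) _ _ _ (by omega) hdvd (by rwa [add_assoc, ← h2])
      exact ⟨c, (((Reaches.of_iterate htest).trans (Reaches.of_iterate hpass)).trans hc).mono
        (by omega), hc'⟩
    · have hfail := block_fail (n := (2 * m - a : ℕ)) (m := m) (X := X) (B := B)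
        (q := (2 ^ i : ℕ)) (Y := (X ^ a : ℕ)) (w := ((1 + X) ^ (2 * m) : ℕ))
        (S := (powerStack B X i : ℕ)) (C := ((2 * m).choose (a + 2 ^ i) : ℕ))
        (z := (X ^ (a + 2 ^ i) : ℕ)) (Nat.cast_lt.2 (lt_of_le_of_ne (Nat.div_mul_le_self _ _)
          fun h => hdvd (Dvd.intro_left _ h)))
      obtain ⟨c, hc, hc'⟩ := ih a _ _ _ (by omega) h0 hdvd
      exact ⟨c, (((Reaches.of_iterate htest).trans (Reaches.of_iterate hfail)).trans hc).mono
        (by omega), hc'⟩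

/-! ### Running time -/

theorem exists_reaches_start_prime (N : ℕ) :
    ∃ c, Reaches primeProgram (36 * Nat.clog 2 (N + 1) + 17) (Config.start N) c ∧
      c.Halted primeProgram ∧ ∃ p : ℕ, p.Prime ∧ N ≤ p ∧ c.reg 0 = p := by
  set k := Nat.clog 2 (N + 1) with hk
  have hNk : N + 1 ≤ 2 ^ k := Nat.le_pow_clog (by norm_num) _
  have hm : 2 ^ k ≠ 0 := by positivity
  have hX : 2 ^ (2 * 2 ^ k) < 8 ^ 2 ^ k := by
    rw [pow_mul]
    exact Nat.pow_lt_pow_left (by norm_num) hm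
  have h₁ := (Reaches.of_iterate (block_start N)).trans
    (reaches_double_m (n := N + 1) (i := k) [0, 0, 0, 0, 0, 0, 0, 0, 0]
      fun j hj => Nat.pow_lt_of_lt_clog hj)
  have h₂ := h₁.trans (Reaches.of_iterate (block_init_q (by exact_mod_cast hNk)))
  obtain ⟨u, v, h₃⟩ := reaches_double_q (n := N + 1) (B := (8 ^ 2 ^ k) ^ 2 ^ k) le_rfl hX
  have h₄ := (h₂.trans h₃).trans (Reaches.of_iterate (block_init_a le_rfl))
  obtain ⟨c, hc, hc', p, hp, hmp, hcp⟩ := exists_reaches_halted_prime hX le_rfl k 0 u v 0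
    (by omega) (by simp) (by simpa using not_choose_dvd hm)
  refine ⟨c, (h₄.trans (Reaches.trans (t₁ := 0) (Reaches.of_iterate ?_) hc)).mono (by omega), hc',
    p, hp, by omega, hcp⟩
  have e1 : ((2 * 2 ^ k - 0 : ℕ) : ℤ) = (2 ^ k : ℕ) + (2 ^ k : ℕ) := by
    rw [Nat.sub_zero]; push_cast; ring
  have e2 : (((1 + 8 ^ 2 ^ k) ^ (2 * 2 ^ k) : ℕ) : ℤ) =
      ((1 + 8 ^ 2 ^ k) ^ 2 ^ k : ℕ) * ((1 + 8 ^ 2 ^ k) ^ 2 ^ k : ℕ) := by push_cast; ring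
  -- Zero steps: both configurations are equal up to the casts.
  rw [e1, e2, pow_zero]
  push_cast
  rfl

/-- `log x ≤ log x ^ 2 / log (log x)`, because `log (log x) ≤ log x`. -/
theorem log_le_log_sq_div_log_log {x : ℝ} (hx : 0 < Real.log (Real.log x))
    (hx' : 0 ≤ Real.log x) : Real.log x ≤ Real.log x ^ 2 / Real.log (Real.log x) := by
  rw [le_div_iff₀ hx, sq]
  exact mul_le_mul_of_nonneg_left (Real.log_le_self hx') hx'

theorem clog_isBigO (a b : ℕ) :
    Asymptotics.IsBigO Filter.atTop (fun N : ℕ => ((a * Nat.clog 2 (N + 1) + b : ℕ) : ℝ))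
      (fun N : ℕ => Real.log (N : ℝ) ^ 2 / Real.log (Real.log (N : ℝ))) := by
  refine Asymptotics.IsBigO.of_bound (a * 4 + b) ?_
  have h1 : Filter.Tendsto (fun N : ℕ => Real.log (N : ℝ)) Filter.atTop Filter.atTop :=
    Real.tendsto_log_atTop.comp tendsto_natCast_atTop_atTop
  filter_upwards [(Real.tendsto_log_atTop.comp h1).eventually_gt_atTop 0,
    h1.eventually_ge_atTop 1, Filter.eventually_ge_atTop 1] with N hN hN1 hN0
  rw [Function.comp_apply] at hN
  have hle := log_le_log_sq_div_log_log hN (by linarith)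
  rw [Real.norm_of_nonneg (by positivity), Real.norm_of_nonneg (by linarith)]
  have hclog : Nat.clog 2 (N + 1) ≤ Nat.log 2 N + 1 :=
    Nat.clog_le_of_le_pow (Nat.lt_pow_succ_log_self (by norm_num) N)
  have hlog : (Nat.log 2 N : ℝ) * Real.log 2 ≤ Real.log N := by
    rw [← Real.log_pow]
    exact Real.log_le_log (by positivity) (by exact_mod_cast Nat.pow_log_le_self 2 (by omega))
  have hlog2 := Real.log_two_gt_d9
  have hc : (Nat.clog 2 (N + 1) : ℝ) ≤ 4 * Real.log N := by
    have : (Nat.clog 2 (N + 1) : ℝ) ≤ Nat.log 2 N + 1 := by exact_mod_cast hclog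
    have h0 : (0 : ℝ) ≤ Nat.log 2 N := by positivity
    nlinarith
  calc ((a * Nat.clog 2 (N + 1) + b : ℕ) : ℝ) = a * Nat.clog 2 (N + 1) + b := by push_cast; ring
    _ ≤ a * (4 * Real.log N) + b * Real.log N := by
        gcongr
        exact le_mul_of_one_le_right (by positivity) hN1
    _ = (a * 4 + b) * Real.log N := by ring
    _ ≤ _ := by gcongr

end RandomizedRAM

theorem proposition3p8 :
    ∃ (P : RandomizedRAM.Program) (T : ℕ → ℕ) (δ : ℝ), 0 < δ ∧
      Asymptotics.IsBigO Filter.atTop (fun N : ℕ => (T N : ℝ))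
        (fun N : ℕ => Real.log (N : ℝ) ^ 2 / Real.log (Real.log (N : ℝ))) ∧
      ∀ N : ℕ,
        RandomizedRAM.HaltsWithin P N (T N) ∧
        ENNReal.ofReal δ ≤
          RandomizedRAM.outputProb P N (T N)
            (fun z : ℤ => ∃ p : ℕ, p.Prime ∧ N ≤ p ∧ z = (p : ℤ)) := by
  refine ⟨RandomizedRAM.primeProgram, fun N => 36 * Nat.clog 2 (N + 1) + 17, 1, one_pos,
    RandomizedRAM.clog_isBigO 36 17, fun N => ?_⟩
  obtain ⟨c, hc, hc', hp⟩ := RandomizedRAM.exists_reaches_start_prime N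
  obtain ⟨h₁, h₂⟩ := hc.haltsWithin_and_outputProb RandomizedRAM.flipFree_primeProgram hc'
    (Q := fun z : ℤ => ∃ p : ℕ, p.Prime ∧ N ≤ p ∧ z = (p : ℤ)) hp
  exact ⟨h₁, by rw [h₂, ENNReal.ofReal_one]⟩
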